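/- **Setting.** Let $d,p\ge 1$, let $E\subseteq\mathbb R^p$ be a measurable set with $0\in E$ and let $A\subseteq E\setminus\{0\}$ be a measurable set (the relevance set). Let $X=\{X_{\mathbf t}:\mathbf t\in\mathbb N^d\}$ be a (strictly) stationary $\mathbb R^p$-valued random field on a probability space, and for $\mathbf n=(n_1,\dots,n_d)\in\mathbb N^d$ let $X_{\mathbf n,\mathbf t}=L_{\mathbf n}(X_{\mathbf t})\mathbf 1_A(X_{\mathbf t})$, where the maps $L_{\mathbf n}:\mathbb R^p\to\mathbb R^p$ are measurable with $L_{\mathbf n}(A)\subseteq E$. Put $v_{\mathbf n}=\mathbb P(X_{\mathbf n,\mathbf 1}\in A)$ and $n_{\mathbf n}=n_1\cdots n_d$. For block sizes $r_i=r_i(n_i)\in\{1,2,\dots\}$ put $r_{\mathbf n}=r_1\cdots r_d$, $m_i=\lfloor n_i/r_i\rfloor$, $D_{\mathbf n}=\prod_{i=1}^d\{1,\dots,m_i\}$, and define the blocks $Y_{\mathbf n,\mathbf j}=(X_{\mathbf n,\mathbf t})_{\mathbf t\in\prod_i\{(j_i-1)r_i+1,\dots,j_ir_i\}}$ for $\mathbf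 j\in D_{\mathbf n}$; let $Y_{\mathbf n}=Y_{\mathbf n,\mathbf 1}$. The notation $\mathbf n\to\infty$ means $n_i\to\infty$ for every $i$. Let $E_\cup$ be the disjoint union, over all sizes $l_1,\dots,l_d\ge1$, of the sets of $E$-valued $l_1\times\cdots\times l_d$ arrays, with the $\sigma$-field induced by the product $\sigma$-fields. The core $\mathcal C(y)$ of $y\in E_\cup$ is the smallest rectangular sub-array of $y$ containing all the sites at which $y$ takes values in $A$, and $\mathcal C(y)=0$ (the one-site array with value $0$) if there is no such site. A *cluster functional* is a measurable $f:E_\cup\to\mathbb R$ with $f(y)=f(\mathcal C(y))$ for all $y$ and $f(0)=0$. Let $\mathcal F$ be a class of cluster functionals and $$Z_{\mathbf n}(f)=\frac1{\sqrt{n_{\mathbf n}v_{\mathbf n}}}\sum_{\mathbf j\in D_{\mathbf n}}\bigl(f(Y_{\mathbf n,\mathbf j})-\mathbb E f(Y_{\mathbf n,\mathbf j})\bigr),\qquad f\in\mathcal F .$$ For $\mathbf f_k=(f_1,\dots,f_k)\in\mathcal F^k$ let $W_{\mathbf n,\mathbf j}=(n_{\mathbf n}v_{\mathbf n})^{-1/2}\bigl(f_s(Y_{\mathbf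 n,\mathbf j})-\mathbb E f_s(Y_{\mathbf n,\mathbf j})\bigr)_{1\le s\le k}$, let $V_{\mathbf n,\mathbf j}=\sum_{\mathbf u}W_{\mathbf n,\mathbf u}$, where $\mathbf u$ runs over the elements of $D_{\mathbf n}$ that come strictly after $\mathbf j$ in the lexicographic order, and for $\mathbf t\in\mathbb R^k$ let $$T_{\mathbf n,\mathbf t}(\mathbf f_k)=\sum_{\mathbf j\in D_{\mathbf n}}\Bigl|\operatorname{Cov}\bigl(e^{\mathrm i\langle\mathbf t,V_{\mathbf n,\mathbf j}\rangle},\,e^{\mathrm i\langle\mathbf t,W_{\mathbf n,\mathbf j}\rangle}\bigr)\Bigr| ,\qquad \operatorname{Cov}(U,U')=\mathbb E[UU']-\mathbb E[U]\,\mathbb E[U'].$$ **Theorem (CLT for cluster functionals on random fields).** Assume, as $\mathbf n\to\infty$: * (Bas) $r_i=o(n_i)$ for each $i$, $r_{\mathbf n}v_{\mathbf n}\to\tau$ for some $\tau<\infty$, and $n_{\mathbf n}v_{\mathbf n}\to\infty$; * (Lin) for all $f\in\mathcal F$ and $\epsilon>0$, $\ (r_{\mathbf n}v_{\mathbf n})^{-1}\,\mathbb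 E\bigl[(f(Y_{\mathbf n})-\mathbb E f(Y_{\mathbf n}))^2\,\mathbf 1_{\{|f(Y_{\mathbf n})-\mathbb E f(Y_{\mathbf n})|>\epsilon\sqrt{n_{\mathbf n}v_{\mathbf n}}\}}\bigr]\to0$; * (Cov) for each $f\in\mathcal F$, $\mathbb E f(Y_{\mathbf n})^2<\infty$ for all large $\mathbf n$, and $(r_{\mathbf n}v_{\mathbf n})^{-1}\operatorname{Cov}(f(Y_{\mathbf n}),g(Y_{\mathbf n}))\to c(f,g)\in\mathbb R$ for all $f,g\in\mathcal F$; * $T_{\mathbf n,\mathbf t}(\mathbf f_k)\to0$ for every $k$, every $\mathbf f_k\in\mathcal F^k$ and every $\mathbf t\in\mathbb R^k$. Then there is a centered Gaussian process $(Z(f))_{f\in\mathcal F}$ with covariance function $c$ such that the finite-dimensional distributions of $Z_{\mathbf n}$ converge to those of $Z$: for every $k$ and all $f_1,\dots,f_k\in\mathcal F$, $(Z_{\mathbf n}(f_1),\dots,Z_{\mathbf n}(f_k))$ converges in distribution to $(Z(f_1),\dots,Z(f_k))$ as $\mathbf n\to\infty$. -/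

import Mathlib

open MeasureTheory ProbabilityTheory Filter Topology

noncomputable section

namespace ClusterCLT

/-- The state space `E`, a measurable subset of `ℝᵖ` containing `0`, together with a measurable
relevance set `A ⊆ E \ {0}`. -/
structure StateSpace (p : ℕ) where
  E : Set (EuclideanSpace ℝ (Fin p))
  A : Set (EuclideanSpace ℝ (Fin p))
  measurableSet_E : MeasurableSet E
  measurableSet_A : MeasurableSet A
  zero_mem : (0 : EuclideanSpace ℝ (Fin p)) ∈ E
  subset : A ⊆ E \ {0}

variable {d p : ℕ}

/-- The space `E_∪` of all `E`-valued arrays of size `l₁ × ⋯ × l_d`, with `l₁, …, l_d ≥ 1`.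
Sites are counted from `0`. The `σ`-field is the one of Mathlib on a disjoint union: a set is
measurable iff its trace on the arrays of each fixed size is measurable for the product
`σ`-field. -/
abbrev Block (d : ℕ) (S : StateSpace p) : Type :=
  Σ l : Fin d → ℕ+, ((i : Fin d) → Fin (l i : ℕ)) → S.E

/-- The one-site block with value `0`, which represents `0` as an element of `E_∪`. -/
def zeroBlock (d : ℕ) (S : StateSpace p) : Block d S :=
  ⟨fun _ => 1, fun _ => ⟨0, S.zero_mem⟩⟩

open Classical in
/-- The sites of a block at which it takes a value in the relevance set. -/
def relevantSites {S : StateSpace p} (y : Block d S) :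
    Finset ((i : Fin d) → Fin (y.1 i : ℕ)) :=
  Finset.univ.filter fun t => (y.2 t : EuclideanSpace ℝ (Fin p)) ∈ S.A

/-- The smallest `i`-th coordinate of a relevant site. -/
def coreMin {S : StateSpace p} (y : Block d S) (h : (relevantSites y).Nonempty) (i : Fin d) :
    Fin (y.1 i : ℕ) :=
  ((relevantSites y).image fun t => t i).min' (h.image _)

/-- The largest `i`-th coordinate of a relevant site. -/
def coreMax {S : StateSpace p} (y : Block d S) (h : (relevantSites y).Nonempty) (i : Fin d) :
    Fin (y.1 i : ℕ) :=
  ((relevantSites y).image fun t => t i).max' (h.image _)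

open Classical in
/-- The core of a block: the smallest sub-array that contains all the relevant sites, and `0`
if there is no relevant site. -/
def core {S : StateSpace p} (y : Block d S) : Block d S :=
  if h : (relevantSites y).Nonempty then
    ⟨fun i => ⟨(coreMax y h i : ℕ) - (coreMin y h i : ℕ) + 1, Nat.succ_pos _⟩,
      fun s => y.2 fun i => ⟨(coreMin y h i : ℕ) + (s i : ℕ), by
        have h1 : (s i : ℕ) < (coreMax y h i : ℕ) - (coreMin y h i : ℕ) + 1 := (s i).isLt
        have h2 : (coreMax y h i : ℕ) < (y.1 i : ℕ) := (coreMax y h i).isLt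
        have h3 : (coreMin y h i : ℕ) < (y.1 i : ℕ) := (coreMin y h i).isLt
        omega⟩⟩
  else zeroBlock d S

/-- Cluster functionals: measurable maps `f : E_∪ → ℝ` with `f(y) = f(C(y))` and `f(0) = 0`. -/
structure ClusterFunctional (d : ℕ) (S : StateSpace p) where
  toFun : Block d S → ℝ
  measurable_toFun : Measurable toFun
  map_core : ∀ y, toFun y = toFun (core y)
  map_zero : toFun (zeroBlock d S) = 0

instance (S : StateSpace p) : CoeFun (ClusterFunctional d S) fun _ => Block d S → ℝ :=
  ⟨ClusterFunctional.toFun⟩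

/-- The measurable normalizing maps `L_n : ℝᵖ → ℝᵖ`, such that `L_n(x) 1_A(x) ∈ E` for all `x`. -/
structure Normalization (d : ℕ) (S : StateSpace p) where
  toFun : (Fin d → ℕ) → EuclideanSpace ℝ (Fin p) → EuclideanSpace ℝ (Fin p)
  measurable_toFun : ∀ n, Measurable (toFun n)
  mem : ∀ n, ∀ x ∈ S.A, toFun n x ∈ S.E

/-- `x ↦ L_n(x) 1_A(x)`, as an `E`-valued map. -/
def Normalization.map {S : StateSpace p} (L : Normalization d S) (n : Fin d → ℕ)
    (x : EuclideanSpace ℝ (Fin p)) : S.E :=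
  ⟨S.A.indicator (L.toFun n) x, by
    by_cases hx : x ∈ S.A
    · rw [Set.indicator_of_mem hx]; exact L.mem n x hx
    · rw [Set.indicator_of_notMem hx]; exact S.zero_mem⟩

variable {Ω : Type*} [MeasurableSpace Ω]

/-- Strict stationarity of a random field on `ℕᵈ` (indices counted from `0`): the law of the
whole field is invariant under every shift. -/
def IsStationary (X : (Fin d → ℕ) → Ω → EuclideanSpace ℝ (Fin p)) (P : Measure Ω) : Prop :=
  (∀ t, Measurable (X t)) ∧
    ∀ h : Fin d → ℕ, P.map (fun ω t => X (t + h) ω) = P.map (fun ω t => X t ω)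

/-- The number `m_i = ⌊n_i / r_i⌋` of complete blocks in direction `i`, where `r_i = r_i(n_i)`. -/
def numBlocks (r : Fin d → ℕ → ℕ+) (n : Fin d → ℕ) (i : Fin d) : ℕ :=
  n i / (r i (n i) : ℕ)

/-- The set `D_n` of block indices (counted from `0`). -/
def blockIndices (r : Fin d → ℕ → ℕ+) (n : Fin d → ℕ) : Finset (Fin d → ℕ) :=
  Fintype.piFinset fun i => Finset.range (numBlocks r n i)

section Fields

variable {S : StateSpace p} (X : (Fin d → ℕ) → Ω → EuclideanSpace ℝ (Fin p))
  (L : Normalization d S) (r : Fin d → ℕ → ℕ+) (P : Measure Ω)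

/-- The normalized observation `X_{n,t} = L_n(X_t) 1_A(X_t)`. -/
def obs (n t : Fin d → ℕ) (ω : Ω) : S.E := L.map n (X t ω)

/-- The random block `Y_{n,j}`, of size `r₁ × ⋯ × r_d`. -/
def block (n j : Fin d → ℕ) (ω : Ω) : Block d S :=
  ⟨fun i => r i (n i), fun s => obs X L n (fun i => j i * (r i (n i) : ℕ) + (s i : ℕ)) ω⟩

/-- `v_n`, the probability that the normalized observation at the first site is relevant. -/
def relProb (n : Fin d → ℕ) : ℝ :=
  P.real {ω | (obs X L n 0 ω : EuclideanSpace ℝ (Fin p)) ∈ S.A}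

/-- `n_n v_n`, where `n_n = n₁ ⋯ n_d`. -/
def nv (n : Fin d → ℕ) : ℝ := (∏ i, (n i : ℝ)) * relProb X L P n

/-- `r_n v_n`, where `r_n = r₁ ⋯ r_d`. -/
def rv (n : Fin d → ℕ) : ℝ := (∏ i, ((r i (n i) : ℕ) : ℝ)) * relProb X L P n

/-- `f(Y_{n,j})`. -/
def blockValue (f : ClusterFunctional d S) (n j : Fin d → ℕ) (ω : Ω) : ℝ :=
  f (block X L r n j ω)

/-- `f(Y_{n,j}) - 𝔼 f(Y_{n,j})`. -/
def centeredValue (f : ClusterFunctional d S) (n j : Fin d → ℕ) (ω : Ω) : ℝ :=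
  blockValue X L r f n j ω - ∫ ω', blockValue X L r f n j ω' ∂P

/-- The empirical process `Z_n(f)` of cluster functionals. -/
def empiricalProcess (f : ClusterFunctional d S) (n : Fin d → ℕ) (ω : Ω) : ℝ :=
  (√(nv X L P n))⁻¹ * ∑ j ∈ blockIndices r n, centeredValue X L r P f n j ω

/-- The random vector `W_{n,j}` of a `k`-tuple of cluster functionals. -/
def W {k : ℕ} (f : Fin k → ClusterFunctional d S) (n j : Fin d → ℕ) (ω : Ω) :
    EuclideanSpace ℝ (Fin k) :=
  WithLp.toLp 2 fun s => (√(nv X L P n))⁻¹ * centeredValue X L r P (f s) n j ω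

open Classical in
/-- The block indices that come strictly after `j` in the lexicographic order. For `d = 2` these
are the `(u₁, u₂) ∈ D_n` that are neither in an earlier row (`u₁ < j₁`) nor among the first entries
of the row of `j` up to `j` itself (`u₁ = j₁` and `u₂ ≤ j₂`). -/
def laterIndices (n j : Fin d → ℕ) : Finset (Fin d → ℕ) :=
  (blockIndices r n).filter fun u => toLex j < toLex u

/-- The sum `V_{n,j}` of the vectors `W_{n,u}` over the block indices `u` after `j`. -/
def V {k : ℕ} (f : Fin k → ClusterFunctional d S) (n j : Fin d → ℕ) (ω : Ω) :
    EuclideanSpace ℝ (Fin k) :=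
  ∑ u ∈ laterIndices r n j, W X L r P f n u ω

/-- The (bilinear, no conjugation) covariance `𝔼[(U - 𝔼U)(U' - 𝔼U')]` of complex random
variables. -/
def complexCov (U U' : Ω → ℂ) : ℂ :=
  ∫ ω, (U ω - ∫ ω', U ω' ∂P) * (U' ω - ∫ ω', U' ω' ∂P) ∂P

/-- The dependence coefficient `T_{n,t}(f_k)`. -/
def depCoeff {k : ℕ} (f : Fin k → ClusterFunctional d S) (t : EuclideanSpace ℝ (Fin k))
    (n : Fin d → ℕ) : ℝ :=
  ∑ j ∈ blockIndices r n,
    ‖complexCov P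
      (fun ω => Complex.exp (Complex.I * ((inner ℝ t (V X L r P f n j ω) : ℝ) : ℂ)))
      (fun ω => Complex.exp (Complex.I * ((inner ℝ t (W X L r P f n j ω) : ℝ) : ℂ)))‖

/-- Assumption (Bas). -/
def Bas : Prop :=
  (∀ i : Fin d, Tendsto (fun m : ℕ => ((r i m : ℕ) : ℝ) / (m : ℝ)) atTop (𝓝 0)) ∧
    (∃ τ : ℝ, Tendsto (rv X L r P) atTop (𝓝 τ)) ∧
    Tendsto (nv X L P) atTop atTop

/-- Assumption (Lin). The generic block `Y_n` is the first block `Y_{n,0}`. -/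
def Lin (𝓕 : Set (ClusterFunctional d S)) : Prop :=
  ∀ f ∈ 𝓕, ∀ ε : ℝ, 0 < ε →
    Tendsto (fun n => (rv X L r P n)⁻¹ *
      ∫ ω in {ω | ε * √(nv X L P n) < |centeredValue X L r P f n 0 ω|},
        (centeredValue X L r P f n 0 ω) ^ 2 ∂P) atTop (𝓝 0)

/-- Assumption (Cov) with limit covariance function `c`. The variables `f(Y_n)`, `f ∈ 𝓕`, are
required to have finite second moments for all large `n`, so that the covariances make sense. -/
def Cov (𝓕 : Set (ClusterFunctional d S)) (c : 𝓕 → 𝓕 → ℝ) : Prop :=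
  (∀ f ∈ 𝓕, ∀ᶠ n in atTop, MemLp (blockValue X L r f n 0) 2 P) ∧
    ∀ f g : 𝓕, Tendsto (fun n => (rv X L r P n)⁻¹ *
      covariance (blockValue X L r f.1 n 0) (blockValue X L r g.1 n 0) P) atTop (𝓝 (c f g))

end Fields

end ClusterCLT

end

/-! By Lévy's theorem it is enough that the characteristic function of $(Z_n(f_1),\dots,Z_n(f_k))$
converges at each $t$ to $\exp(-\frac12\sum_{s,u}t_st_uc(f_s,f_u))$.

The dependence between blocks is removed by telescoping. Splitting off one block at a time in
lexicographic order, the characteristic function of the sum differs from the product of those of the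
summands by at most $T_{n,t}$, which tends to 0 (`norm_integral_exp_sum_sub_prod_le`). By
stationarity all blocks have the same law, so the product is a power $\varphi_n^{m_n}$ with
$m_n=|D_n|$ (`norm_integral_exp_empiricalProcess_sub_pow_le`).

What remains is the i.i.d. Lindeberg theorem: a second-order expansion gives
$m_n(\varphi_n-1)\to-\sigma^2/2$, hence $\varphi_n^{m_n}\to e^{-\sigma^2/2}$
(`tendsto_integral_exp_pow`). Its variance and Lindeberg hypotheses are (Cov) and (Lin),
renormalized by means of $m_nr_n/n_n\to1$; (Bas) also gives $m_n\to\infty$.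

The limit process exists because $c$, a limit of rescaled covariances, is symmetric and positive
semidefinite. It is then the Gram kernel of vectors in a reproducing kernel Hilbert space, and an
isometry of that space into the $L^2$ closure of the span of independent standard Gaussians turns
the vectors into a Gaussian process (`exists_isGaussianProcess`). -/

namespace ClusterCLT

universe u

/-! ### Lévy's theorem, and Gaussian processes with prescribed covariance. -/

section Gaussian

/-- **Lévy's convergence theorem** along a countably generated filter. -/
lemma tendsto_of_tendsto_charFun {ι E : Type*} [NormedAddCommGroup E] [InnerProductSpace ℝ E]
    [FiniteDimensional ℝ E] [MeasurableSpace E] [BorelSpace E] {l : Filter ι}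
    [l.IsCountablyGenerated] {μ : ι → ProbabilityMeasure E} {μ₀ : ProbabilityMeasure E}
    (h : ∀ t : E,
      Tendsto (fun n ↦ charFun (μ n : Measure E) t) l (𝓝 (charFun (μ₀ : Measure E) t))) :
    Tendsto μ l (𝓝 μ₀) :=
  -- A countably generated filter, such as `atTop` on `Fin d → ℕ`, is tested along sequences, which
  -- reduces to the sequential theorem.
  tendsto_of_seq_tendsto fun _ hx ↦
    ProbabilityMeasure.tendsto_iff_tendsto_charFun.2 fun t ↦ (h t).comp hx

variable {Ω : Type*} [MeasurableSpace Ω] {P : Measure Ω} [IsProbabilityMeasure P]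

lemma charFun_gaussianReal_zero_nnnorm {E : Type*} [SeminormedAddCommGroup E] (x : E) (t : ℝ) :
    charFun (gaussianReal 0 (‖x‖₊ ^ 2)) t = Complex.exp (-((‖x‖ : ℂ) ^ 2 * t ^ 2 / 2)) := by
  rw [charFun_gaussianReal]
  simp

/-- Convergence in $L^2$ implies convergence in law, and the variance is the squared norm, which is
continuous. This carries Gaussianity from finite linear combinations to their closed span. -/
lemma isClosed_setOf_map_eq_gaussianReal :
    IsClosed {f : Lp ℝ 2 P | P.map f = gaussianReal 0 (‖f‖₊ ^ 2)} := by
  refine IsSeqClosed.isClosed fun F f hF hlim ↦ ?_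
  have hdist : TendstoInDistribution (fun n ↦ (F n : Ω → ℝ)) atTop (f : Ω → ℝ) (fun _ ↦ P) P :=
    (tendstoInMeasure_of_tendsto_Lp hlim).tendstoInDistribution
      fun n ↦ (Lp.aestronglyMeasurable _).aemeasurable
  have hchar := ProbabilityMeasure.tendsto_iff_tendsto_charFun.1 hdist.tendsto
  have := Measure.isProbabilityMeasure_map (μ := P) (Lp.aestronglyMeasurable f).aemeasurable
  refine Measure.ext_of_charFun (funext fun t ↦ tendsto_nhds_unique (hchar t) ?_)
  have hF' : ∀ n, P.map (F n) = gaussianReal 0 (‖F n‖₊ ^ 2) := hF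
  simp only [ProbabilityMeasure.coe_mk, hF', charFun_gaussianReal_zero_nnnorm]
  have hn : Tendsto (fun n ↦ (‖F n‖ : ℂ)) atTop (𝓝 (‖f‖ : ℂ)) :=
    (Complex.continuous_ofReal.tendsto _).comp hlim.norm
  exact (Complex.continuous_exp.tendsto _).comp
    ((((hn.pow 2).mul_const _).div_const _).neg)

/-- The `i`-th coordinate of a family of independent standard Gaussian variables, as an element
of `L²`. -/
noncomputable def coordLp (ι : Type*) (i : ι) :
    Lp ℝ 2 (Measure.infinitePi fun _ : ι ↦ gaussianReal 0 1) :=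
  MemLp.toLp (fun ω ↦ ω i) ((memLp_id_gaussianReal 2).comp_measurePreserving
    (measurePreserving_eval_infinitePi (fun _ : ι ↦ gaussianReal 0 1) i))

lemma coeFn_coordLp (ι : Type*) (i : ι) :
    coordLp ι i =ᵐ[Measure.infinitePi fun _ : ι ↦ gaussianReal 0 1] fun ω ↦ ω i :=
  MemLp.coeFn_toLp _

lemma iIndepFun_eval_gaussian (ι : Type*) :
    iIndepFun (fun i (ω : ι → ℝ) ↦ ω i) (Measure.infinitePi fun _ : ι ↦ gaussianReal 0 1) :=
  iIndepFun_infinitePi (X := fun _ x ↦ x) fun _ ↦ measurable_id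

/-- The coordinates are centered, so the $L^2$ inner product is the covariance; independence kills
it off the diagonal. -/
lemma orthonormal_coordLp (ι : Type*) : Orthonormal ℝ (coordLp ι) := by
  classical
  have hlp : ∀ i : ι, MemLp (fun ω : ι → ℝ ↦ ω i) 2
      (Measure.infinitePi fun _ : ι ↦ gaussianReal 0 1) := fun i ↦
    (memLp_id_gaussianReal 2).comp_measurePreserving
      (measurePreserving_eval_infinitePi (fun _ : ι ↦ gaussianReal 0 1) i)
  have hmean : ∀ i : ι,
      ∫ ω : ι → ℝ, ω i ∂(Measure.infinitePi fun _ : ι ↦ gaussianReal 0 1) = 0 := by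
    intro i
    have := integral_map (μ := Measure.infinitePi fun _ : ι ↦ gaussianReal 0 1)
      (φ := fun ω ↦ ω i) (f := fun x : ℝ ↦ x) (measurable_pi_apply i).aemeasurable (by fun_prop)
    rw [← this, Measure.infinitePi_map_eval]
    exact integral_id_gaussianReal
  have hinner : ∀ i j : ι, inner ℝ (coordLp ι i) (coordLp ι j) =
      cov[fun ω : ι → ℝ ↦ ω i, fun ω ↦ ω j; Measure.infinitePi fun _ : ι ↦ gaussianReal 0 1] := by
    intro i j
    rw [L2.inner_def, covariance, hmean, hmean]
    refine integral_congr_ae ?_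
    filter_upwards [coeFn_coordLp ι i, coeFn_coordLp ι j] with ω hi hj
    simp [hi, hj, mul_comm]
  rw [orthonormal_iff_ite]
  intro i j
  rw [hinner]
  split_ifs with hij
  · subst hij
    rw [covariance_self (measurable_pi_apply i).aemeasurable]
    have := variance_map (μ := Measure.infinitePi fun _ : ι ↦ gaussianReal 0 1)
      (X := id) (Y := fun ω : ι → ℝ ↦ ω i) (by fun_prop) (measurable_pi_apply i).aemeasurable
    rw [Measure.infinitePi_map_eval, variance_id_gaussianReal] at this
    exact this.symm
  · exact ((iIndepFun_eval_gaussian ι).indepFun hij).covariance_eq_zero (hlp i) (hlp j)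

/-- Independence factors the characteristic function, and orthonormality identifies the resulting
$\sum a_i^2$ with the squared norm. -/
lemma map_sum_coordLp (ι : Type*) (s : Finset ι) (a : ι → ℝ) :
    (Measure.infinitePi fun _ : ι ↦ gaussianReal 0 1).map
      (∑ i ∈ s, a i • coordLp ι i : Lp ℝ 2 (Measure.infinitePi fun _ : ι ↦ gaussianReal 0 1)) =
      gaussianReal 0 (‖∑ i ∈ s, a i • coordLp ι i‖₊ ^ 2) := by
  have hae : (∑ i ∈ s, a i • coordLp ι i :
      Lp ℝ 2 (Measure.infinitePi fun _ : ι ↦ gaussianReal 0 1)) =ᵐ[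
      Measure.infinitePi fun _ : ι ↦ gaussianReal 0 1] fun ω ↦ ∑ i ∈ s, a i * ω i := by
    have h : ∀ᵐ ω ∂(Measure.infinitePi fun _ : ι ↦ gaussianReal 0 1), ∀ i ∈ s,
        (a i • coordLp ι i : Lp ℝ 2 (Measure.infinitePi fun _ : ι ↦ gaussianReal 0 1)) ω =
          a i * ω i := by
      refine (ae_ball_iff s.countable_toSet).2 fun i _ ↦ ?_
      filter_upwards [Lp.coeFn_smul (a i) (coordLp ι i), coeFn_coordLp ι i] with ω h1 h2
      rw [h1, Pi.smul_apply, h2, smul_eq_mul]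
    filter_upwards [Lp.coeFn_fun_finsetSum s fun i ↦ a i • coordLp ι i, h] with ω h1 h2
    rw [h1]
    exact Finset.sum_congr rfl h2
  have hmeas : ∀ i, Measurable fun ω : ι → ℝ ↦ a i * ω i := fun i ↦
    (measurable_pi_apply i).const_mul _
  rw [Measure.map_congr hae]
  have : IsProbabilityMeasure ((Measure.infinitePi fun _ : ι ↦ gaussianReal 0 1).map
      fun ω ↦ ∑ i ∈ s, a i * ω i) :=
    Measure.isProbabilityMeasure_map (Finset.measurable_fun_sum _ fun i _ ↦ hmeas i).aemeasurable
  refine Measure.ext_of_charFun (funext fun t ↦ ?_)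
  have hind : iIndepFun (fun i (ω : ι → ℝ) ↦ a i * ω i)
      (Measure.infinitePi fun _ : ι ↦ gaussianReal 0 1) :=
    (iIndepFun_eval_gaussian ι).comp (fun i x ↦ a i * x) (fun _ ↦ by fun_prop)
  rw [charFun_gaussianReal_zero_nnnorm,
    iIndepFun.charFun_map_fun_finsetSum_eq_prod (fun i _ ↦ (hmeas i).aemeasurable)
      (hind.restrict _), Finset.prod_apply]
  have hnorm : ‖∑ i ∈ s, a i • coordLp ι i‖ ^ 2 = ∑ i ∈ s, a i ^ 2 := by
    rw [← real_inner_self_eq_norm_sq, (orthonormal_coordLp ι).inner_sum]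
    simp [sq]
  rw [← Complex.ofReal_pow, hnorm]
  have hterm : ∀ i, charFun ((Measure.infinitePi fun _ : ι ↦ gaussianReal 0 1).map
      fun ω ↦ a i * ω i) t = Complex.exp (-((a i : ℂ) ^ 2 * t ^ 2 / 2)) := by
    intro i
    rw [charFun_map_mul_comp (measurable_pi_apply i).aemeasurable, Measure.infinitePi_map_eval,
      charFun_gaussianReal]
    simp [mul_pow]
  simp only [hterm, ← Complex.exp_sum]
  simp [Finset.sum_mul, Finset.sum_div]

/-- The **isonormal Gaussian process** of a Hilbert space `H`. -/
theorem exists_isonormal {H : Type u} [NormedAddCommGroup H] [InnerProductSpace ℝ H]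
    [CompleteSpace H] :
    ∃ (ι : Type u) (U : H →ₗᵢ[ℝ] Lp ℝ 2 (Measure.infinitePi fun _ : ι ↦ gaussianReal 0 1)),
      ∀ h, (Measure.infinitePi fun _ : ι ↦ gaussianReal 0 1).map (U h) =
        gaussianReal 0 (‖h‖₊ ^ 2) := by
  obtain ⟨w, b, -⟩ := exists_hilbertBasis ℝ H
  have hO := (orthonormal_coordLp w).orthogonalFamily
  refine ⟨w, hO.linearIsometry.comp b.repr.toLinearIsometry, fun h ↦ ?_⟩
  -- The image of `h` is the $L^2$ limit of finite combinations of coordinates, with the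
  -- coefficients of `h` in the Hilbert basis.
  have hmem := isClosed_setOf_map_eq_gaussianReal.mem_of_tendsto
    (hO.hasSum_linearIsometry (b.repr h)) (.of_forall fun s ↦ ?_)
  · simpa using hmem
  · exact map_sum_coordLp w s _

/-- A symmetric positive semidefinite kernel is the Gram matrix of a family of vectors in a Hilbert
space. -/
lemma exists_inner_eq_kernel {T : Type u} (c : T → T → ℝ) (hsymm : ∀ i j, c i j = c j i)
    (hpos : ∀ (s : Finset T) (a : T → ℝ), 0 ≤ ∑ i ∈ s, ∑ j ∈ s, a i * a j * c i j) :
    ∃ (H : Type u) (_ : NormedAddCommGroup H) (_ : InnerProductSpace ℝ H) (_ : CompleteSpace H)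
      (φ : T → H), ∀ i j, inner ℝ (φ i) (φ j) = c i j := by
  -- Reproducing kernels are operator-valued here, so the scalar `c i j` acts by multiplication on
  -- ℝ.
  let K : Matrix T T (ℝ →L[ℝ] ℝ) := Matrix.of fun i j ↦ c i j • (1 : ℝ →L[ℝ] ℝ)
  have hK : K.PosSemidef := by
    have htfae := (RKHS.posSemidef_tfae (𝕜 := ℝ) (K := K)).out 0 2 rfl rfl
    refine htfae.2 ⟨?_, fun v ↦ ?_⟩
    · ext i j
      simp [K, hsymm i j]
    · refine (hpos v.support v).trans_eq ?_
      simp only [Finsupp.sum, K]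
      refine Finset.sum_congr rfl fun i _ ↦ Finset.sum_congr rfl fun j _ ↦ ?_
      simp [hsymm i j]
      ring
  have : Fact K.PosSemidef := ⟨hK⟩
  refine ⟨RKHS.OfKernel K, inferInstance, inferInstance, inferInstance,
    fun i ↦ RKHS.kerFun (RKHS.OfKernel K) i 1, fun i j ↦ ?_⟩
  rw [← RKHS.kernel_inner, RKHS.OfKernel.kernel_ofKernel]
  simp [K, hsymm i j]

/-- A symmetric positive semidefinite kernel is the covariance function of a centered Gaussian
process. -/
theorem exists_isGaussianProcess {T : Type u} (c : T → T → ℝ) (hsymm : ∀ i j, c i j = c j i)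
    (hpos : ∀ (s : Finset T) (a : T → ℝ), 0 ≤ ∑ i ∈ s, ∑ j ∈ s, a i * a j * c i j) :
    ∃ (Ω : Type u) (_ : MeasurableSpace Ω) (P : Measure Ω) (_ : IsProbabilityMeasure P)
      (Z : T → Ω → ℝ), IsGaussianProcess Z P ∧ (∀ i, ∫ ω, Z i ω ∂P = 0) ∧
        ∀ i j, cov[Z i, Z j; P] = c i j := by
  classical
  obtain ⟨H, _, _, _, φ, hφ⟩ := exists_inner_eq_kernel c hsymm hpos
  obtain ⟨ι, U, hU⟩ := exists_isonormal (H := H)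
  have haem : ∀ h, AEMeasurable (U h) (Measure.infinitePi fun _ : ι ↦ gaussianReal 0 1) := fun h ↦
    (Lp.aestronglyMeasurable _).aemeasurable
  have hmean : ∀ i, ∫ ω, U (φ i) ω ∂(Measure.infinitePi fun _ : ι ↦ gaussianReal 0 1) = 0 := by
    intro i
    rw [← integral_map (φ := U (φ i)) (f := fun x : ℝ ↦ x) (haem _) (by fun_prop), hU]
    exact integral_id_gaussianReal
  refine ⟨ι → ℝ, inferInstance, Measure.infinitePi fun _ : ι ↦ gaussianReal 0 1, inferInstance,
    fun i ↦ U (φ i), ⟨fun I ↦ ⟨?_⟩⟩, hmean, fun i j ↦ ?_⟩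
  · refine isGaussian_of_map_eq_gaussianReal fun L ↦ ?_
    -- By linearity, `L` of the vector is almost surely `U` of $\sum_i L(e_i)\varphi_i$, which
    -- dictates the variance.
    refine ⟨0, ‖∑ i : I, L (Pi.single i 1) • φ i‖₊ ^ 2, ?_⟩
    rw [← hU, AEMeasurable.map_map_of_aemeasurable L.continuous.measurable.aemeasurable
      (aemeasurable_pi_lambda (fun ω ↦ I.restrict fun x ↦ U (φ x) ω) fun i ↦ haem _)]
    refine Measure.map_congr ?_
    have h : ∀ᵐ ω ∂(Measure.infinitePi fun _ : ι ↦ gaussianReal 0 1), ∀ i : I,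
        (L (Pi.single i 1) • U (φ i) :
          Lp ℝ 2 (Measure.infinitePi fun _ : ι ↦ gaussianReal 0 1)) ω =
          L (Pi.single i 1) * U (φ i) ω :=
      ae_all_iff.2 fun i ↦ by
        filter_upwards [Lp.coeFn_smul (L (Pi.single i 1)) (U (φ i))] with ω h1
        rw [h1, Pi.smul_apply, smul_eq_mul]
    filter_upwards [Lp.coeFn_fun_finsetSum Finset.univ
      fun i : I ↦ L (Pi.single i 1) • U (φ i), h] with ω h1 h2
    simp only [map_sum, map_smul]
    rw [h1, Finset.sum_congr rfl fun i _ ↦ h2 i, Function.comp_apply,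
      ← LinearMap.sum_single_apply (φ := fun _ ↦ ℝ) (I.restrict fun i ↦ U (φ i) ω), map_sum]
    refine Finset.sum_congr rfl fun i _ ↦ ?_
    rw [mul_comm, ← smul_eq_mul, ← map_smul, ← Pi.single_smul]
    simp
  · rw [← hφ i j, ← U.inner_map_map, L2.inner_def, covariance, hmean, hmean]
    simp [mul_comm]

end Gaussian

/-! ### Lindeberg's theorem for powers of characteristic functions. -/

section Lindeberg

variable {Ω : Type*} [MeasurableSpace Ω] {P : Measure Ω} [IsProbabilityMeasure P]

lemma norm_pow_sub_pow_le {z w : ℂ} (hz : ‖z‖ ≤ 1) (hw : ‖w‖ ≤ 1) (m : ℕ) :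
    ‖z ^ m - w ^ m‖ ≤ m * ‖z - w‖ := by
  induction m with
  | zero => simp
  | succ m ih =>
    have h : z ^ (m + 1) - w ^ (m + 1) = z * (z ^ m - w ^ m) + (z - w) * w ^ m := by ring
    have h1 : ‖z * (z ^ m - w ^ m)‖ ≤ m * ‖z - w‖ := by
      rw [norm_mul]
      exact (mul_le_of_le_one_left (norm_nonneg _) hz).trans ih
    have h2 : ‖(z - w) * w ^ m‖ ≤ ‖z - w‖ := by
      rw [norm_mul, norm_pow]
      exact mul_le_of_le_one_right (norm_nonneg _) (pow_le_one₀ (norm_nonneg _) hw)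
    rw [h]
    push_cast
    linarith [norm_add_le (z * (z ^ m - w ^ m)) ((z - w) * w ^ m)]

/-- If $|x|\le\varepsilon$, the remainder is cubic and $|x|^3\le\varepsilon x^2$. If
$|x|>\varepsilon$, the terms are estimated separately: $2\le 2x^2/\varepsilon^2$ for the exponential
and 1, $|x|\le x^2/\varepsilon$ for the linear term, and $x^2/2$. -/
lemma norm_exp_I_mul_sub_taylor_le {ε : ℝ} (hε : 0 < ε) (hε1 : ε ≤ 1) (x : ℝ) :
    ‖Complex.exp (Complex.I * x) - 1 - Complex.I * x + (x : ℂ) ^ 2 / 2‖ ≤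
      ε * x ^ 2 + (2 / ε ^ 2 + 1 / ε + 1 / 2) * {y : ℝ | ε < |y|}.indicator (fun y ↦ y ^ 2) x := by
  by_cases hx : ε < |x|
  · rw [Set.indicator_of_mem (by exact hx)]
    have h1 : ‖Complex.exp (Complex.I * x)‖ = 1 := Complex.norm_exp_I_mul_ofReal x
    have h2 : ‖Complex.I * (x : ℂ)‖ = |x| := by simp
    have h3 : ‖(x : ℂ) ^ 2 / 2‖ = x ^ 2 / 2 := by simp
    have h4 : 2 ≤ 2 / ε ^ 2 * x ^ 2 := by
      rw [div_mul_eq_mul_div, le_div_iff₀ (by positivity), ← sq_abs x]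
      nlinarith
    have h5 : |x| ≤ 1 / ε * x ^ 2 := by
      rw [div_mul_eq_mul_div, le_div_iff₀ (by positivity), ← sq_abs x]
      nlinarith [abs_nonneg x]
    have h6 := norm_add_le (Complex.exp (Complex.I * x) - 1 - Complex.I * x) ((x : ℂ) ^ 2 / 2)
    have h7 := norm_sub_le (Complex.exp (Complex.I * x) - 1) (Complex.I * x)
    have h8 := norm_sub_le (Complex.exp (Complex.I * x)) 1
    rw [norm_one] at h8
    have h9 : 0 ≤ ε * x ^ 2 := by positivity
    linarith
  · rw [Set.indicator_of_notMem (by exact hx)]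
    push Not at hx
    have hx' : ‖Complex.I * (x : ℂ)‖ = |x| := by simp
    have hb := Complex.exp_bound (x := Complex.I * x) (by rw [hx']; linarith) (n := 3) (by norm_num)
    rw [hx'] at hb
    have hs : ∑ m ∈ Finset.range 3, (Complex.I * x) ^ m / (m.factorial : ℂ) =
        1 + Complex.I * x - (x : ℂ) ^ 2 / 2 := by
      simp [Finset.sum_range_succ, mul_pow, Nat.factorial]
      ring
    rw [hs] at hb
    have he : Complex.exp (Complex.I * x) - 1 - Complex.I * x + (x : ℂ) ^ 2 / 2 =
        Complex.exp (Complex.I * x) - (1 + Complex.I * x - (x : ℂ) ^ 2 / 2) := by ring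
    rw [he]
    refine hb.trans ?_
    have h3 : |x| ^ 3 ≤ ε * x ^ 2 := by
      rw [← sq_abs x, pow_succ, mul_comm]
      gcongr
    have h0 : 0 ≤ |x| ^ 3 := by positivity
    norm_num [Nat.factorial]
    linarith

variable {ι : Type*} {l : Filter ι} {x : ι → Ω → ℝ} {m : ι → ℕ} {v : ℝ}

/-- The second-order expansion of the characteristic functions of a Lindeberg array. -/
lemma tendsto_mul_integral_exp_sub_one (hx : ∀ᶠ n in l, MemLp (x n) 2 P)
    (hmean : ∀ᶠ n in l, ∫ ω, x n ω ∂P = 0)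
    (hv : Tendsto (fun n ↦ (m n : ℝ) * ∫ ω, x n ω ^ 2 ∂P) l (𝓝 v))
    (hLin : ∀ ε : ℝ, 0 < ε →
      Tendsto (fun n ↦ (m n : ℝ) * ∫ ω, {y : ℝ | ε < |y|}.indicator (fun y ↦ y ^ 2) (x n ω) ∂P)
        l (𝓝 0)) :
    Tendsto (fun n ↦ (m n : ℂ) * ((∫ ω, Complex.exp (Complex.I * x n ω) ∂P) - 1)) l
      (𝓝 (-(v / 2) : ℝ)) := by
  have hrem : ∀ᶠ n in l, ∀ ε : ℝ, 0 < ε → ε ≤ 1 →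
      ‖(m n : ℂ) * ((∫ ω, Complex.exp (Complex.I * x n ω) ∂P) - 1) +
        (((m n : ℝ) * ∫ ω, x n ω ^ 2 ∂P : ℝ) : ℂ) / 2‖ ≤
      ε * ((m n : ℝ) * ∫ ω, x n ω ^ 2 ∂P) + (2 / ε ^ 2 + 1 / ε + 1 / 2) *
        ((m n : ℝ) * ∫ ω, {y : ℝ | ε < |y|}.indicator (fun y ↦ y ^ 2) (x n ω) ∂P) := by
    filter_upwards [hx, hmean] with n hn hn0 ε hε hε1
    have hsq : Integrable (fun ω ↦ x n ω ^ 2) P := hn.integrable_sq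
    have hind : Integrable (fun ω ↦ {y : ℝ | ε < |y|}.indicator (fun y ↦ y ^ 2) (x n ω)) P := by
      refine hsq.mono' ?_ (.of_forall fun ω ↦ ?_)
      · have : Measurable ({y : ℝ | ε < |y|}.indicator fun y : ℝ ↦ y ^ 2) :=
          (by fun_prop : Measurable fun y : ℝ ↦ y ^ 2).indicator
            (measurableSet_lt measurable_const (by fun_prop))
        exact (this.comp_aemeasurable hn.1.aemeasurable).aestronglyMeasurable
      · rw [Real.norm_of_nonneg (Set.indicator_nonneg (fun y _ ↦ sq_nonneg y) _)]
        exact Set.indicator_le_self' (fun y _ ↦ sq_nonneg y) _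
    have hexp : Integrable (fun ω ↦ Complex.exp (Complex.I * x n ω)) P := by
      refine Integrable.of_bound (C := 1) ?_ (.of_forall fun ω ↦
        (Complex.norm_exp_I_mul_ofReal _).le)
      exact (by fun_prop : Continuous fun y : ℝ ↦
        Complex.exp (Complex.I * y)).comp_aestronglyMeasurable hn.1
    have h1 : Integrable (x n) P := hn.integrable (by norm_num)
    have hI : ∫ ω, (Complex.exp (Complex.I * x n ω) - 1 - Complex.I * x n ω +
        (x n ω : ℂ) ^ 2 / 2) ∂P = ((∫ ω, Complex.exp (Complex.I * x n ω) ∂P) - 1) +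
          ((∫ ω, x n ω ^ 2 ∂P : ℝ) : ℂ) / 2 := by
      have hc1 : Integrable (fun ω ↦ Complex.I * (x n ω : ℂ)) P := h1.ofReal.const_mul _
      have hc2 : Integrable (fun ω ↦ (x n ω : ℂ) ^ 2 / 2) P := by
        simpa using hsq.ofReal (𝕜 := ℂ) |>.div_const 2
      have hc3 : Integrable (fun ω ↦ Complex.exp (Complex.I * x n ω) - 1) P :=
        hexp.sub (integrable_const _)
      have hc4 : Integrable (fun ω ↦ Complex.exp (Complex.I * x n ω) - 1 - Complex.I * x n ω) P :=
        hc3.sub hc1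
      rw [integral_add hc4 hc2, integral_sub hc3 hc1, integral_sub hexp (integrable_const _),
        integral_const_mul, integral_complex_ofReal, hn0, integral_div]
      simp only [← Complex.ofReal_pow, integral_complex_ofReal]
      simp
    have hle := norm_integral_le_of_norm_le
      ((hsq.const_mul ε).add (hind.const_mul (2 / ε ^ 2 + 1 / ε + 1 / 2)))
      (.of_forall fun ω ↦ norm_exp_I_mul_sub_taylor_le hε hε1 (x n ω))
    rw [hI] at hle
    simp only [Pi.add_apply] at hle
    rw [integral_add (hsq.const_mul ε) (hind.const_mul _), integral_const_mul,
      integral_const_mul] at hle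
    have := mul_le_mul_of_nonneg_left hle (Nat.cast_nonneg (α := ℝ) (m n))
    rw [← Complex.norm_natCast, ← norm_mul, Complex.norm_natCast] at this
    refine (le_of_eq ?_).trans (this.trans_eq (by ring))
    congr 1
    push_cast
    ring
  have hzero : Tendsto (fun n ↦ (m n : ℂ) * ((∫ ω, Complex.exp (Complex.I * x n ω) ∂P) - 1) +
      (((m n : ℝ) * ∫ ω, x n ω ^ 2 ∂P : ℝ) : ℂ) / 2) l (𝓝 0) := by
    rw [tendsto_zero_iff_norm_tendsto_zero, Metric.tendsto_nhds]
    intro δ hδ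
    -- The bound in `hrem` tends to `ε * v`, which must be below `δ`; the cap 1 is what the Taylor
    -- estimate requires.
    set ε := min 1 (δ / (2 * (|v| + 1))) with hε
    have hεpos : 0 < ε := by positivity
    have hεv : ε * v < δ := by
      have h1 : ε * v ≤ ε * |v| := by gcongr; exact le_abs_self v
      have h2 : ε * (2 * (|v| + 1)) ≤ δ := by
        rw [← le_div_iff₀ (by positivity)]
        exact min_le_right _ _
      nlinarith [abs_nonneg v]
    have hlim := (hv.const_mul ε).add ((hLin ε hεpos).const_mul (2 / ε ^ 2 + 1 / ε + 1 / 2))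
    rw [mul_zero, add_zero] at hlim
    filter_upwards [hlim.eventually_lt_const hεv, hrem] with n h1 h2
    rw [dist_zero_right, norm_norm]
    exact (h2 ε hεpos (min_le_left _ _)).trans_lt h1
  have hv' : Tendsto (fun n ↦ (((m n : ℝ) * ∫ ω, x n ω ^ 2 ∂P : ℝ) : ℂ) / 2) l (𝓝 ((v : ℂ) / 2)) :=
    ((Complex.continuous_ofReal.tendsto _).comp hv).div_const _
  simpa using hzero.sub hv'

/-- Compare `φ n` with $e^{-s/m}$: both lie in the unit disc, so their $m$-th powers differ by at
most $m|\varphi_n-e^{-s/m}|$. This avoids complex logarithms. -/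
lemma tendsto_pow_exp_of_tendsto_mul_sub_one {φ : ι → ℂ} {s : ℝ} (hs : 0 ≤ s)
    (hφ : ∀ n, ‖φ n‖ ≤ 1) (hm : Tendsto m l atTop)
    (h : Tendsto (fun n ↦ (m n : ℂ) * (φ n - 1)) l (𝓝 (-s : ℝ))) :
    Tendsto (fun n ↦ φ n ^ m n) l (𝓝 (Complex.exp (-s : ℝ))) := by
  -- This is the derivative of $e^{-sy}$ at 0, along $y=1/k$.
  have hg : Tendsto (fun k : ℕ ↦ (k : ℂ) * (Complex.exp ((-s / k : ℝ)) - 1)) atTop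
      (𝓝 ((-s : ℝ) : ℂ)) := by
    have hd : HasDerivAt (fun y : ℝ ↦ Real.exp (-s * y)) (-s) 0 := by
      simpa using ((hasDerivAt_id (0 : ℝ)).const_mul (-s)).exp
    have hk : Tendsto (fun k : ℕ ↦ ((k : ℝ))⁻¹) atTop (𝓝[≠] 0) :=
      (tendsto_inv_atTop_nhdsGT_zero.comp tendsto_natCast_atTop_atTop).mono_right
        (nhdsWithin_mono _ fun y hy ↦ ne_of_gt hy)
    refine ((Complex.continuous_ofReal.tendsto _).comp
      (hd.tendsto_slope_zero.comp hk)).congr fun k ↦ ?_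
    simp [div_eq_mul_inv]
  have hdiff : Tendsto (fun n ↦ (m n : ℂ) * (φ n - Complex.exp ((-s / m n : ℝ)))) l (𝓝 0) := by
    have := h.sub (hg.comp hm)
    rw [sub_self] at this
    refine this.congr fun n ↦ ?_
    simp only [Function.comp_apply]
    ring
  have hpow : Tendsto (fun n ↦ φ n ^ m n - Complex.exp ((-s / m n : ℝ)) ^ m n) l (𝓝 0) := by
    refine squeeze_zero_norm (fun n ↦ ?_) (tendsto_zero_iff_norm_tendsto_zero.1 hdiff)
    rw [norm_mul, Complex.norm_natCast]
    refine norm_pow_sub_pow_le (hφ n) ?_ _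
    rw [Complex.norm_exp, Complex.ofReal_re, Real.exp_le_one_iff, neg_div]
    exact neg_nonpos.2 (by positivity)
  have := hpow.add_const (Complex.exp (-s : ℝ))
  rw [zero_add] at this
  refine this.congr' ?_
  filter_upwards [hm.eventually_ge_atTop 1] with n hn
  rw [← Complex.exp_nat_mul]
  have : ((m n : ℕ) : ℂ) ≠ 0 := by exact_mod_cast (by omega : m n ≠ 0)
  have h2 : (m n : ℂ) * ((-s / m n : ℝ) : ℂ) = ((-s : ℝ) : ℂ) := by
    push_cast
    field_simp
  rw [h2]
  ring

/-- **Lindeberg's theorem** for the `m n`-th powers of the characteristic functions of the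
variables `x n`. -/
theorem tendsto_integral_exp_pow (hx : ∀ᶠ n in l, MemLp (x n) 2 P)
    (hmean : ∀ᶠ n in l, ∫ ω, x n ω ∂P = 0) (hm : Tendsto m l atTop) (hv0 : 0 ≤ v)
    (hv : Tendsto (fun n ↦ (m n : ℝ) * ∫ ω, x n ω ^ 2 ∂P) l (𝓝 v))
    (hLin : ∀ ε : ℝ, 0 < ε →
      Tendsto (fun n ↦ (m n : ℝ) * ∫ ω, {y : ℝ | ε < |y|}.indicator (fun y ↦ y ^ 2) (x n ω) ∂P)
        l (𝓝 0)) :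
    Tendsto (fun n ↦ (∫ ω, Complex.exp (Complex.I * x n ω) ∂P) ^ m n) l
      (𝓝 (Complex.exp (-(v / 2) : ℝ))) := by
  refine tendsto_pow_exp_of_tendsto_mul_sub_one (by positivity) (fun n ↦ ?_) hm
    (tendsto_mul_integral_exp_sub_one hx hmean hv hLin)
  refine (norm_integral_le_integral_norm _).trans ?_
  simp [Complex.norm_exp_I_mul_ofReal]

end Lindeberg

variable {d p : ℕ} {Ω : Type*} [MeasurableSpace Ω]

/-! ### From the characteristic function of a sum to a product. -/

section Telescoping

variable {P : Measure Ω} [IsProbabilityMeasure P]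

lemma complexCov_eq_sub {U V : Ω → ℂ} (hU : Integrable U P) (hV : Integrable V P)
    (hUV : Integrable (fun ω ↦ U ω * V ω) P) :
    complexCov P U V = ∫ ω, U ω * V ω ∂P - (∫ ω, U ω ∂P) * ∫ ω, V ω ∂P := by
  have h : ∀ ω, (U ω - ∫ ω', U ω' ∂P) * (V ω - ∫ ω', V ω' ∂P) =
      U ω * V ω - U ω * (∫ ω', V ω' ∂P) -
        ((∫ ω', U ω' ∂P) * V ω - (∫ ω', U ω' ∂P) * ∫ ω', V ω' ∂P) := fun ω ↦ by ring
  have h1 : Integrable (fun ω ↦ U ω * V ω - U ω * (∫ ω', V ω' ∂P)) P := hUV.sub (hU.mul_const _)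
  have h2 : Integrable (fun ω ↦ (∫ ω', U ω' ∂P) * V ω - (∫ ω', U ω' ∂P) * ∫ ω', V ω' ∂P) P :=
    (hV.const_mul _).sub (integrable_const _)
  rw [complexCov, integral_congr_ae (.of_forall h), integral_sub h1 h2,
    integral_sub hUV (hU.mul_const _), integral_sub (hV.const_mul _) (integrable_const _),
    integral_mul_const, integral_const_mul]
  simp

lemma integrable_exp_I_mul {X : Ω → ℝ} (hX : AEMeasurable X P) :
    Integrable (fun ω ↦ Complex.exp (Complex.I * X ω)) P :=
  Integrable.of_bound (C := 1)
    ((by fun_prop : Continuous fun y : ℝ ↦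
      Complex.exp (Complex.I * y)).comp_aestronglyMeasurable hX.aestronglyMeasurable)
    (.of_forall fun _ ↦ (Complex.norm_exp_I_mul_ofReal _).le)

lemma norm_integral_exp_I_mul_le_one (X : Ω → ℝ) :
    ‖∫ ω, Complex.exp (Complex.I * X ω) ∂P‖ ≤ 1 :=
  (norm_integral_le_integral_norm _).trans (by simp [Complex.norm_exp_I_mul_ofReal])

/-- The characteristic function of a sum differs from the product of the characteristic functions
by at most the sum of the covariances between each term and the sum of the later ones. -/
lemma norm_integral_exp_sum_sub_prod_le {α : Type*} [LinearOrder α] (s : Finset α)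
    {x : α → Ω → ℝ} (hx : ∀ a, AEMeasurable (x a) P) :
    ‖∫ ω, Complex.exp (Complex.I * (∑ a ∈ s, x a ω : ℝ)) ∂P -
        ∏ a ∈ s, ∫ ω, Complex.exp (Complex.I * x a ω) ∂P‖ ≤
      ∑ a ∈ s, ‖complexCov P (fun ω ↦ Complex.exp (Complex.I * (∑ b ∈ s with a < b, x b ω : ℝ)))
        (fun ω ↦ Complex.exp (Complex.I * x a ω))‖ := by
  -- Inserting a new minimum `a` makes all of `s` later than `a` and leaves the later sets of the
  -- other indices unchanged.
  induction s using Finset.induction_on_min with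
  | empty => simp
  | insert a s has ih =>
    have ha : a ∉ s := fun h ↦ lt_irrefl _ (has a h)
    have hS : AEMeasurable (fun ω ↦ ∑ b ∈ s, x b ω) P :=
      Finset.aemeasurable_fun_sum _ fun b _ ↦ hx b
    have hmul : ∀ ω, Complex.exp (Complex.I * (∑ b ∈ insert a s, x b ω : ℝ)) =
        Complex.exp (Complex.I * (∑ b ∈ s, x b ω : ℝ)) * Complex.exp (Complex.I * x a ω) := by
      intro ω
      rw [Finset.sum_insert ha, ← Complex.exp_add]
      push_cast
      ring_nf
    have hfa : (insert a s).filter (a < ·) = s := by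
      ext b
      simp only [Finset.mem_filter, Finset.mem_insert]
      refine ⟨?_, fun hb ↦ ⟨.inr hb, has b hb⟩⟩
      rintro ⟨rfl | hb, hlt⟩
      · exact absurd hlt (lt_irrefl _)
      · exact hb
    have hfb : ∀ b ∈ s, (insert a s).filter (b < ·) = s.filter (b < ·) := by
      intro b hb
      rw [Finset.filter_insert, if_neg (has b hb).not_gt]
    have hint : Integrable (fun ω ↦ Complex.exp (Complex.I * (∑ b ∈ s, x b ω : ℝ)) *
        Complex.exp (Complex.I * x a ω)) P := by
      simp only [← hmul]
      exact integrable_exp_I_mul (Finset.aemeasurable_fun_sum _ fun b _ ↦ hx b)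
    have hcov := complexCov_eq_sub (integrable_exp_I_mul hS) (integrable_exp_I_mul (hx a)) hint
    rw [Finset.sum_insert ha, Finset.prod_insert ha, hfa]
    rw [Finset.sum_congr rfl fun b hb ↦ by rw [hfb b hb]]
    simp only [hmul]
    refine le_trans ?_ (add_le_add_right ih _)
    -- The error inherited from `s` is multiplied by a characteristic function of modulus at most 1,
    -- so errors add without growing.
    have hle : ‖(∫ ω, Complex.exp (Complex.I * x a ω) ∂P) *
        (∫ ω, Complex.exp (Complex.I * (∑ b ∈ s, x b ω : ℝ)) ∂P -
          ∏ b ∈ s, ∫ ω, Complex.exp (Complex.I * x b ω) ∂P)‖ ≤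
        ‖∫ ω, Complex.exp (Complex.I * (∑ b ∈ s, x b ω : ℝ)) ∂P -
          ∏ b ∈ s, ∫ ω, Complex.exp (Complex.I * x b ω) ∂P‖ := by
      rw [norm_mul]
      exact mul_le_of_le_one_left (norm_nonneg _) (norm_integral_exp_I_mul_le_one _)
    refine le_trans ?_ (add_le_add_right hle _)
    rw [hcov]
    refine (le_of_eq ?_).trans (norm_add_le _ _)
    congr 1
    ring

end Telescoping

/-! ### Number of blocks and coverage of the sites. -/

section Counting

lemma tendsto_eval_atTop_pi (i : Fin d) : Tendsto (fun n : Fin d → ℕ ↦ n i) atTop atTop :=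
  tendsto_atTop.2 fun b ↦ (eventually_ge_atTop fun _ ↦ b).mono fun _ hn ↦ hn i

lemma card_blockIndices (r : Fin d → ℕ → ℕ+) (n : Fin d → ℕ) :
    (blockIndices r n).card = ∏ i, numBlocks r n i := by
  simp [blockIndices, Fintype.card_piFinset]

/-- The complete blocks cover almost all the sites. -/
lemma tendsto_card_blockIndices_mul_div {r : Fin d → ℕ → ℕ+}
    (hr : ∀ i : Fin d, Tendsto (fun m : ℕ => ((r i m : ℕ) : ℝ) / (m : ℝ)) atTop (𝓝 0)) :
    Tendsto (fun n : Fin d → ℕ ↦ ((blockIndices r n).card : ℝ) * (∏ i, ((r i (n i) : ℕ) : ℝ)) /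
      ∏ i, (n i : ℝ)) atTop (𝓝 1) := by
  have hone : ∀ i : Fin d, Tendsto (fun m : ℕ ↦ ((m / (r i m : ℕ) : ℕ) : ℝ) * ((r i m : ℕ) : ℝ) / m)
      atTop (𝓝 1) := by
    intro i
    have hlow := (hr i).const_sub 1
    rw [sub_zero] at hlow
    -- Fewer than $r$ sites are left over in each direction: $1-r/m\le\lfloor m/r\rfloor r/m\le1$.
    refine tendsto_of_tendsto_of_tendsto_of_le_of_le' hlow tendsto_const_nhds ?_ ?_
    · filter_upwards [eventually_gt_atTop 0] with m hm
      have hm' : (0 : ℝ) < m := by exact_mod_cast hm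
      rw [le_div_iff₀ hm', sub_mul, div_mul_cancel₀ _ hm'.ne', one_mul, sub_le_iff_le_add]
      have := Nat.div_add_mod m (r i m : ℕ)
      have h2 := Nat.mod_lt m (r i m).pos
      have h3 : m ≤ m / (r i m : ℕ) * (r i m : ℕ) + (r i m : ℕ) := by
        rw [mul_comm]; omega
      exact_mod_cast h3
    · filter_upwards [eventually_gt_atTop 0] with m hm
      have hm' : (0 : ℝ) < m := by exact_mod_cast hm
      rw [div_le_one hm']
      exact_mod_cast Nat.div_mul_le_self m (r i m : ℕ)
  have hprod := tendsto_finsetProd (Finset.univ : Finset (Fin d))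
    fun i _ ↦ (hone i).comp (tendsto_eval_atTop_pi i)
  simp only [Finset.prod_const_one] at hprod
  refine hprod.congr fun n ↦ ?_
  rw [card_blockIndices]
  simp [numBlocks, Finset.prod_mul_distrib, Finset.prod_div_distrib]

end Counting

/-! ### Measurability of the blocks and equality of their laws. -/

section Stationarity

variable {S : StateSpace p} {X : (Fin d → ℕ) → Ω → EuclideanSpace ℝ (Fin p)} {P : Measure Ω}

lemma Normalization.measurable_map (L : Normalization d S) (n : Fin d → ℕ) :
    Measurable (L.map n) :=
  ((L.measurable_toFun n).indicator S.measurableSet_A).subtype_mk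

/-- The block of size `r_n` at the origin, as a function of the whole field. -/
noncomputable def fieldBlock (L : Normalization d S) (r : Fin d → ℕ → ℕ+) (n : Fin d → ℕ)
    (x : (Fin d → ℕ) → EuclideanSpace ℝ (Fin p)) : Block d S :=
  ⟨fun i => r i (n i), fun s => L.map n (x fun i => (s i : ℕ))⟩

lemma measurable_fieldBlock (L : Normalization d S) (r : Fin d → ℕ → ℕ+) (n : Fin d → ℕ) :
    Measurable (fieldBlock L r n) := by
  have h1 : Measurable fun (x : (Fin d → ℕ) → EuclideanSpace ℝ (Fin p))
      (s : (i : Fin d) → Fin (r i (n i) : ℕ)) ↦ L.map n (x fun i => (s i : ℕ)) :=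
    measurable_pi_lambda _ fun s ↦ (L.measurable_map n).comp (measurable_pi_apply _)
  have h2 : Measurable fun y : ((i : Fin d) → Fin (r i (n i) : ℕ)) → S.E ↦
      (⟨fun i => r i (n i), y⟩ : Block d S) :=
    -- The σ-field of the disjoint union is an infimum over sizes, so a measurable set has a
    -- measurable trace on this size.
    fun _ hs ↦ MeasurableSpace.measurableSet_iInf.1 hs fun i => r i (n i)
  exact h2.comp h1

/-- Every block is one fixed functional of a shifted field; the shift is then absorbed by
stationarity. -/
lemma block_eq_fieldBlock {Ω : Type*} {S : StateSpace p}
    {X : (Fin d → ℕ) → Ω → EuclideanSpace ℝ (Fin p)} (L : Normalization d S) (r : Fin d → ℕ → ℕ+)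
    (n j : Fin d → ℕ) (ω : Ω) :
    block X L r n j ω =
      fieldBlock L r n fun t ↦ X (t + fun i ↦ j i * (r i (n i) : ℕ)) ω := by
  simp only [block, fieldBlock, obs]
  congr 1
  funext s
  congr 3
  funext i
  exact add_comm _ _

lemma measurable_block (hX : ∀ t, Measurable (X t)) (L : Normalization d S)
    (r : Fin d → ℕ → ℕ+) (n j : Fin d → ℕ) : Measurable (block X L r n j) := by
  rw [funext (block_eq_fieldBlock L r n j)]
  exact (measurable_fieldBlock L r n).comp (measurable_pi_lambda _ fun t ↦ hX _)

/-- All the blocks of a stationary field have the same law. -/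
lemma map_block_eq (hX : IsStationary X P) (L : Normalization d S)
    (r : Fin d → ℕ → ℕ+) (n j : Fin d → ℕ) :
    P.map (block X L r n j) = P.map (block X L r n 0) := by
  have h : ∀ j, P.map (block X L r n j) = (P.map fun ω t ↦ X t ω).map (fieldBlock L r n) := by
    intro j
    rw [← hX.2 fun i ↦ j i * (r i (n i) : ℕ), Measure.map_map (measurable_fieldBlock L r n)
      (measurable_pi_lambda _ fun t ↦ hX.1 _), funext (block_eq_fieldBlock L r n j)]
    rfl
  rw [h, h]

end Stationarity

variable {P : Measure Ω} {S : StateSpace p} {X : (Fin d → ℕ) → Ω → EuclideanSpace ℝ (Fin p)}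
  {L : Normalization d S}
  {r : Fin d → ℕ → ℕ+}

/-! ### Reduction of the empirical process to identically distributed blocks. -/

section Blocks

lemma measurable_blockValue (hX : IsStationary X P) (f : ClusterFunctional d S)
    (n j : Fin d → ℕ) : Measurable (blockValue X L r f n j) :=
  f.measurable_toFun.comp (measurable_block hX.1 L r n j)

lemma measurable_centeredValue (hX : IsStationary X P) (f : ClusterFunctional d S)
    (n j : Fin d → ℕ) : Measurable (centeredValue X L r P f n j) :=
  (measurable_blockValue hX f n j).sub_const _

lemma measurable_empiricalProcess (hX : IsStationary X P) (f : ClusterFunctional d S)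
    (n : Fin d → ℕ) : Measurable (empiricalProcess X L r P f n) :=
  (Finset.measurable_fun_sum _ fun j _ ↦ measurable_centeredValue hX f n j).const_mul _

lemma measurable_W (hX : IsStationary X P) {k : ℕ} (f : Fin k → ClusterFunctional d S)
    (n j : Fin d → ℕ) : Measurable (W X L r P f n j) :=
  (WithLp.measurable_toLp 2 _).comp
    (measurable_pi_lambda _ fun s ↦ (measurable_centeredValue hX (f s) n j).const_mul _)

lemma integral_comp_block_eq (hX : IsStationary X P) {E : Type*} [NormedAddCommGroup E]
    [NormedSpace ℝ E] {F : Block d S → E} (hF : StronglyMeasurable F) (n j : Fin d → ℕ) :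
    ∫ ω, F (block X L r n j ω) ∂P = ∫ ω, F (block X L r n 0 ω) ∂P := by
  rw [← integral_map (measurable_block hX.1 L r n j).aemeasurable hF.aestronglyMeasurable,
    ← integral_map (measurable_block hX.1 L r n 0).aemeasurable hF.aestronglyMeasurable,
    map_block_eq hX]

/-- The vectors `W_{n,j}` have the same characteristic function for all `j`. -/
lemma integral_exp_inner_W_eq (hX : IsStationary X P) {k : ℕ}
    (f : Fin k → ClusterFunctional d S) (t : EuclideanSpace ℝ (Fin k)) (n j : Fin d → ℕ) :
    ∫ ω, Complex.exp (Complex.I * (inner ℝ t (W X L r P f n j ω) : ℝ)) ∂P =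
      ∫ ω, Complex.exp (Complex.I * (inner ℝ t (W X L r P f n 0 ω) : ℝ)) ∂P := by
  have hmean : ∀ s, ∫ ω, blockValue X L r (f s) n j ω ∂P = ∫ ω, blockValue X L r (f s) n 0 ω ∂P :=
    fun s ↦ integral_comp_block_eq hX (f s).measurable_toFun.stronglyMeasurable n j
  -- Centering by the mean of block 0, which by `hmean` is that of block `j`, makes `F` independent
  -- of `j`.
  let F : Block d S → ℂ := fun y ↦ Complex.exp (Complex.I * (inner ℝ t (WithLp.toLp 2 fun s ↦
    (√(nv X L P n))⁻¹ * (f s y - ∫ ω, blockValue X L r (f s) n 0 ω ∂P)) : ℝ))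
  have hF : StronglyMeasurable F := by
    have h : Measurable fun y : Block d S ↦ WithLp.toLp 2 fun s : Fin k ↦
        (√(nv X L P n))⁻¹ * (f s y - ∫ ω, blockValue X L r (f s) n 0 ω ∂P) :=
      (WithLp.measurable_toLp 2 _).comp
        (measurable_pi_lambda _ fun s ↦ ((f s).measurable_toFun.sub_const _).const_mul _)
    exact ((by fun_prop : Continuous fun z : EuclideanSpace ℝ (Fin k) ↦
      Complex.exp (Complex.I * (inner ℝ t z : ℝ))).measurable.comp h).stronglyMeasurable
  have h := integral_comp_block_eq (L := L) (r := r) hX hF n j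
  simp only [W, centeredValue, hmean]
  exact h

lemma toLp_empiricalProcess {k : ℕ} (f : Fin k → ClusterFunctional d S) (n : Fin d → ℕ) (ω : Ω) :
    WithLp.toLp 2 (fun s ↦ empiricalProcess X L r P (f s) n ω) =
      ∑ j ∈ blockIndices r n, W X L r P f n j ω := by
  ext s
  simp [empiricalProcess, W, Finset.mul_sum]

/-- The characteristic function of the empirical process is close to that of a sum of independent
copies of `W_{n,0}`. -/
lemma norm_integral_exp_empiricalProcess_sub_pow_le [IsProbabilityMeasure P]
    (hX : IsStationary X P) {k : ℕ} (f : Fin k → ClusterFunctional d S)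
    (t : EuclideanSpace ℝ (Fin k)) (n : Fin d → ℕ) :
    ‖∫ ω, Complex.exp (Complex.I * (inner ℝ t
        (WithLp.toLp 2 fun s ↦ empiricalProcess X L r P (f s) n ω) : ℝ)) ∂P -
      (∫ ω, Complex.exp (Complex.I * (inner ℝ t (W X L r P f n 0 ω) : ℝ)) ∂P) ^
        (blockIndices r n).card‖ ≤ depCoeff X L r P f t n := by
  classical
  -- Moving the indices to `Lex` supplies the linear order for which the later sets are
  -- `laterIndices`.
  have h := norm_integral_exp_sum_sub_prod_le (P := P) ((blockIndices r n).map toLex.toEmbedding)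
    (x := fun a ω ↦ inner ℝ t (W X L r P f n (ofLex a) ω))
    fun a ↦ ((by fun_prop : Continuous fun z : EuclideanSpace ℝ (Fin k) ↦
      inner ℝ t z).measurable.comp (measurable_W hX f n _)).aemeasurable
  simp only [Finset.sum_map, Finset.card_map, Equiv.coe_toEmbedding, ofLex_toLex, Finset.filter_map,
    integral_exp_inner_W_eq hX f t n, Finset.prod_const] at h
  simp only [toLp_empiricalProcess, inner_sum, depCoeff]
  refine h.trans (le_of_eq (Finset.sum_congr rfl fun j _ ↦ ?_))
  congr 2
  funext ω
  rw [V, inner_sum, laterIndices]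
  congr! 4
  ext u
  simp only [Finset.mem_filter, Function.comp_apply]
  exact Iff.rfl

end Blocks

/-! ### Variance and Lindeberg conditions for the blocks. -/

section Asymptotics

/-- Trades the normalization $n_nv_n$ for the $r_nv_n$ of (Lin) and (Cov), at the cost of a factor
that tends to 1 when $m=|D_n|$. -/
lemma mul_inv_nv (n : Fin d → ℕ) (m : ℝ) :
    m * (nv X L P n)⁻¹ = m * (∏ i, ((r i (n i) : ℕ) : ℝ)) / (∏ i, (n i : ℝ)) *
      (rv X L r P n)⁻¹ := by
  have : (∏ i, ((r i (n i) : ℕ) : ℝ)) ≠ 0 :=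
    Finset.prod_ne_zero_iff.2 fun i _ ↦ by exact_mod_cast (r i (n i)).ne_zero
  rw [nv, rv, mul_inv, mul_inv]
  field_simp

lemma nv_nonneg (n : Fin d → ℕ) : 0 ≤ nv X L P n :=
  mul_nonneg (Finset.prod_nonneg fun _ _ ↦ Nat.cast_nonneg _) measureReal_nonneg

lemma rv_nonneg (n : Fin d → ℕ) : 0 ≤ rv X L r P n :=
  mul_nonneg (Finset.prod_nonneg fun _ _ ↦ Nat.cast_nonneg _) measureReal_nonneg

/-- The product $m_n\cdot r_nv_n=(m_nr_n/n_n)\cdot n_nv_n$ diverges while $r_nv_n$ stays below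
$|\tau|+1$, a positive bound even for $\tau=0$. -/
lemma tendsto_card_blockIndices (hBas : Bas X L r P) :
    Tendsto (fun n ↦ (blockIndices r n).card) atTop atTop := by
  obtain ⟨hr, ⟨τ, hτ⟩, hnv⟩ := hBas
  have h1 := (tendsto_card_blockIndices_mul_div hr).pos_mul_atTop one_pos hnv
  rw [← tendsto_natCast_atTop_iff (R := ℝ)]
  refine tendsto_atTop_mono' _ ?_ (h1.atTop_div_const (show 0 < |τ| + 1 by positivity))
  filter_upwards [hτ.eventually_le_const (show τ < |τ| + 1 by linarith [le_abs_self τ]),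
    hnv.eventually_gt_atTop 0] with n hn hn0
  have hN : (∏ i, (n i : ℝ)) ≠ 0 := fun h ↦ by simp [nv, h] at hn0
  rw [div_le_iff₀ (by positivity)]
  refine le_trans (le_of_eq ?_) (mul_le_mul_of_nonneg_left hn (Nat.cast_nonneg _))
  rw [nv, rv]
  field_simp

variable {𝓕 : Set (ClusterFunctional d S)} {c : 𝓕 → 𝓕 → ℝ}

lemma Cov.symm (hCov : Cov X L r P 𝓕 c) (f g : 𝓕) : c f g = c g f :=
  tendsto_nhds_unique (hCov.2 f g) (by simpa only [covariance_comm] using hCov.2 g f)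

variable {k : ℕ}

lemma inner_W_eq_sum (f : Fin k → ClusterFunctional d S) (t : EuclideanSpace ℝ (Fin k))
    (n j : Fin d → ℕ) (ω : Ω) : inner ℝ t (W X L r P f n j ω) =
      ∑ s, t s * (√(nv X L P n))⁻¹ * centeredValue X L r P (f s) n j ω := by
  simp only [W, PiLp.inner_apply, RCLike.inner_apply, conj_trivial]
  refine Finset.sum_congr rfl fun s _ ↦ ?_
  ring

lemma Cov.eventually_memLp (hCov : Cov X L r P 𝓕 c) (f : Fin k → 𝓕) :
    ∀ᶠ n in atTop, ∀ s, MemLp (blockValue X L r (f s).1 n 0) 2 P :=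
  eventually_all.2 fun s ↦ hCov.1 _ (f s).2

variable [IsProbabilityMeasure P]

/-- The quadratic form is a limit of nonnegative multiples of variances of $\sum_f a_f f(Y_n)$. -/
lemma Cov.sum_nonneg (hCov : Cov X L r P 𝓕 c) (s : Finset 𝓕) (a : 𝓕 → ℝ) :
    0 ≤ ∑ f ∈ s, ∑ g ∈ s, a f * a g * c f g := by
  have hlim := tendsto_finsetSum s fun f _ ↦ tendsto_finsetSum s fun g _ ↦
    (hCov.2 f g).const_mul (a f * a g)
  refine ge_of_tendsto hlim ?_
  filter_upwards [(eventually_all_finset s).2 fun f _ ↦ hCov.1 f.1 f.2] with n hn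
  have hvar := variance_fun_sum' (μ := P) (s := s)
    (X := fun f ω ↦ a f * blockValue X L r f.1 n 0 ω) fun f hf ↦ (hn f hf).const_mul (a f)
  have h0 := mul_nonneg (inv_nonneg.2 (rv_nonneg (X := X) (L := L) (r := r) (P := P) n))
    (variance_nonneg (fun ω ↦ ∑ f ∈ s, a f * blockValue X L r f.1 n 0 ω) P)
  rw [hvar] at h0
  refine h0.trans_eq ?_
  simp only [Finset.mul_sum, covariance_const_mul_left, covariance_const_mul_right]
  refine Finset.sum_congr rfl fun f _ ↦ Finset.sum_congr rfl fun g _ ↦ ?_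
  ring

lemma memLp_centeredValue {f : ClusterFunctional d S} {n j : Fin d → ℕ}
    (h : MemLp (blockValue X L r f n j) 2 P) : MemLp (centeredValue X L r P f n j) 2 P :=
  h.sub (memLp_const _)

lemma Cov.eventually_memLp_inner_W (hCov : Cov X L r P 𝓕 c) (f : Fin k → 𝓕)
    (t : EuclideanSpace ℝ (Fin k)) :
    ∀ᶠ n in atTop, MemLp (fun ω ↦ (inner ℝ t (W X L r P (fun s ↦ (f s).1) n 0 ω) : ℝ)) 2 P := by
  filter_upwards [hCov.eventually_memLp f] with n hn
  simp only [inner_W_eq_sum]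
  exact memLp_finsetSum _ fun s _ ↦ (memLp_centeredValue (hn s)).const_mul _

lemma Cov.eventually_integral_inner_W (hCov : Cov X L r P 𝓕 c) (f : Fin k → 𝓕)
    (t : EuclideanSpace ℝ (Fin k)) :
    ∀ᶠ n in atTop, ∫ ω, (inner ℝ t (W X L r P (fun s ↦ (f s).1) n 0 ω) : ℝ) ∂P = 0 := by
  filter_upwards [hCov.eventually_memLp f] with n hn
  simp only [inner_W_eq_sum]
  rw [integral_finsetSum _ fun s _ ↦
    ((memLp_centeredValue (hn s)).integrable (by norm_num)).const_mul _]
  refine Finset.sum_eq_zero fun s _ ↦ ?_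
  have := integral_sub ((hn s).integrable (by norm_num))
    (integrable_const (μ := P) (∫ ω', blockValue X L r (f s).1 n 0 ω' ∂P))
  rw [integral_const_mul]
  simp only [centeredValue]
  rw [this]
  simp

/-- Expanding the square leaves terms
$(m_nr_n/n_n)\cdot(r_nv_n)^{-1}\mathrm{Cov}(f_s(Y_n),f_u(Y_n))$, whose factors converge separately.
-/
lemma tendsto_card_mul_integral_sq (hBas : Bas X L r P) (hCov : Cov X L r P 𝓕 c) (f : Fin k → 𝓕)
    (t : EuclideanSpace ℝ (Fin k)) :
    Tendsto (fun n ↦ ((blockIndices r n).card : ℝ) *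
      ∫ ω, (inner ℝ t (W X L r P (fun s ↦ (f s).1) n 0 ω) : ℝ) ^ 2 ∂P) atTop
      (𝓝 (∑ s, ∑ u, t s * t u * c (f s) (f u))) := by
  have hlim := tendsto_finsetSum Finset.univ fun s _ ↦ tendsto_finsetSum Finset.univ fun u _ ↦
    (((tendsto_card_blockIndices_mul_div hBas.1).mul (hCov.2 (f s) (f u))).const_mul (t s * t u))
  simp only [one_mul] at hlim
  refine hlim.congr' ?_
  filter_upwards [hCov.eventually_memLp f] with n hn
  have hint : ∀ s u, Integrable (fun ω ↦
      t s * (√(nv X L P n))⁻¹ * centeredValue X L r P (f s).1 n 0 ω *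
        (t u * (√(nv X L P n))⁻¹ * centeredValue X L r P (f u).1 n 0 ω)) P := fun s u ↦
    ((memLp_centeredValue (hn s)).const_mul _).integrable_mul
      ((memLp_centeredValue (hn u)).const_mul _)
  simp only [inner_W_eq_sum, sq, Finset.sum_mul_sum]
  rw [integral_finsetSum _ fun s _ ↦ integrable_finsetSum _ fun u _ ↦ hint s u, Finset.mul_sum]
  refine Finset.sum_congr rfl fun s _ ↦ ?_
  rw [integral_finsetSum _ fun u _ ↦ hint s u, Finset.mul_sum]
  refine Finset.sum_congr rfl fun u _ ↦ ?_
  have hsq : (√(nv X L P n))⁻¹ * (√(nv X L P n))⁻¹ = (nv X L P n)⁻¹ := by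
    rw [← mul_inv, Real.mul_self_sqrt (nv_nonneg n)]
  have hcov : ∫ ω, t s * (√(nv X L P n))⁻¹ * centeredValue X L r P (f s).1 n 0 ω *
        (t u * (√(nv X L P n))⁻¹ * centeredValue X L r P (f u).1 n 0 ω) ∂P =
      t s * t u * ((nv X L P n)⁻¹ *
        cov[blockValue X L r (f s).1 n 0, blockValue X L r (f u).1 n 0; P]) := by
    rw [covariance, ← integral_const_mul, ← integral_const_mul]
    refine integral_congr_ae (.of_forall fun ω ↦ ?_)
    simp only [← hsq, centeredValue]
    ring
  rw [hcov, mul_left_comm ((blockIndices r n).card : ℝ), ← mul_assoc ((blockIndices r n).card : ℝ) (nv X L P n)⁻¹,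
    mul_inv_nv (r := r), mul_assoc (_ / _)]

/-- A sum is large only if one of its terms is. -/
lemma indicator_sum_sq_le (ε : ℝ) (t a : Fin k → ℝ) :
    {y : ℝ | ε < |y|}.indicator (fun y ↦ y ^ 2) (∑ s, t s * a s) ≤
      (k : ℝ) ^ 2 * ∑ s, t s ^ 2 *
        {y : ℝ | ε / (k * (|t s| + 1)) < |y|}.indicator (fun y ↦ y ^ 2) (a s) := by
  have hnn : ∀ s, 0 ≤ t s ^ 2 *
      {y : ℝ | ε / (k * (|t s| + 1)) < |y|}.indicator (fun y ↦ y ^ 2) (a s) := fun s ↦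
    mul_nonneg (sq_nonneg _) (Set.indicator_nonneg (fun y _ ↦ sq_nonneg y) _)
  by_cases h : ε < |∑ s, t s * a s|
  swap
  · rw [Set.indicator_of_notMem (by exact h)]
    exact mul_nonneg (sq_nonneg _) (Finset.sum_nonneg fun s _ ↦ hnn s)
  rw [Set.indicator_of_mem (by exact h)]
  rcases Nat.eq_zero_or_pos k with rfl | hk
  · simp
  have : Nonempty (Fin k) := ⟨⟨0, hk⟩⟩
  -- The largest term is at least $1/k$ of the sum, so this single `s` carries the bound; the `+ 1`
  -- in its threshold allows `t s = 0`.
  obtain ⟨s, -, hs⟩ := Finset.exists_max_image Finset.univ (fun s ↦ |t s * a s|)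
    Finset.univ_nonempty
  have hle : |∑ s, t s * a s| ≤ k * |t s * a s| := by
    refine (Finset.abs_sum_le_sum_abs _ _).trans
      ((Finset.sum_le_card_nsmul _ _ _ hs).trans_eq ?_)
    simp
  have hk' : (0 : ℝ) < k := by exact_mod_cast hk
  have hmem : ε / (k * (|t s| + 1)) < |a s| := by
    rw [div_lt_iff₀ (by positivity)]
    rw [abs_mul] at hle
    have : 0 ≤ k * |a s| := by positivity
    nlinarith
  refine le_trans ?_ (mul_le_mul_of_nonneg_left
    (Finset.single_le_sum (fun s _ ↦ hnn s) (Finset.mem_univ s)) (sq_nonneg _))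
  rw [Set.indicator_of_mem (by exact hmem), ← sq_abs, ← mul_pow, ← sq_abs (t s * a s), ← mul_pow]
  gcongr

/-- `indicator_sum_sq_le` reduces the linear combination to (Lin) for each `f s` at level
$\varepsilon/(k(|t_s|+1))$. -/
lemma tendsto_card_mul_integral_indicator (hX : IsStationary X P) (hBas : Bas X L r P)
    (hLin : Lin X L r P 𝓕) (hCov : Cov X L r P 𝓕 c) (f : Fin k → 𝓕)
    (t : EuclideanSpace ℝ (Fin k)) {ε : ℝ} (hε : 0 < ε) :
    Tendsto (fun n ↦ ((blockIndices r n).card : ℝ) *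
      ∫ ω, {y : ℝ | ε < |y|}.indicator (fun y ↦ y ^ 2)
        (inner ℝ t (W X L r P (fun s ↦ (f s).1) n 0 ω)) ∂P) atTop (𝓝 0) := by
  rcases Nat.eq_zero_or_pos k with rfl | hk
  · simp [inner_W_eq_sum, Set.indicator]
  have hk' : (0 : ℝ) < k := by exact_mod_cast hk
  have hlim := (tendsto_finsetSum Finset.univ fun s _ ↦
    (((tendsto_card_blockIndices_mul_div hBas.1).mul
      (hLin (f s).1 (f s).2 (ε / (k * (|t s| + 1))) (by positivity))).const_mul
        (t s ^ 2))).const_mul ((k : ℝ) ^ 2)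
  simp only [mul_zero, Finset.sum_const_zero] at hlim
  refine squeeze_zero' (.of_forall fun n ↦ mul_nonneg (Nat.cast_nonneg _)
    (integral_nonneg fun ω ↦ Set.indicator_nonneg (fun y _ ↦ sq_nonneg y) _)) ?_ hlim
  filter_upwards [hCov.eventually_memLp f, hBas.2.2.eventually_gt_atTop 0] with n hn hn0
  set A : Fin k → Set Ω := fun s ↦ {ω | ε / (k * (|t s| + 1)) * √(nv X L P n) <
    |centeredValue X L r P (f s).1 n 0 ω|} with hA
  have hAmeas : ∀ s, MeasurableSet (A s) := fun s ↦
    measurableSet_lt measurable_const (measurable_centeredValue hX _ n 0).abs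
  have hpt : ∀ ω, {y : ℝ | ε < |y|}.indicator (fun y ↦ y ^ 2)
      (inner ℝ t (W X L r P (fun s ↦ (f s).1) n 0 ω)) ≤
      (k : ℝ) ^ 2 * ∑ s, t s ^ 2 * ((nv X L P n)⁻¹ *
        (A s).indicator (fun ω ↦ centeredValue X L r P (f s).1 n 0 ω ^ 2) ω) := by
    intro ω
    simp only [inner_W_eq_sum, mul_assoc]
    refine (indicator_sum_sq_le ε t _).trans_eq ?_
    congr 1
    refine Finset.sum_congr rfl fun s _ ↦ ?_
    congr 1
    have hiff : ε / (k * (|t s| + 1)) < |(√(nv X L P n))⁻¹ * centeredValue X L r P (f s).1 n 0 ω| ↔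
        ω ∈ A s := by
      rw [abs_mul, abs_of_nonneg (inv_nonneg.2 (Real.sqrt_nonneg _)), inv_mul_eq_div,
        lt_div_iff₀ (Real.sqrt_pos.2 hn0)]
      rfl
    by_cases h : ω ∈ A s
    · rw [Set.indicator_of_mem (by exact hiff.2 h), Set.indicator_of_mem h, mul_pow, inv_pow,
        Real.sq_sqrt hn0.le]
    · rw [Set.indicator_of_notMem (by exact fun h' ↦ h (hiff.1 h')), Set.indicator_of_notMem h,
        mul_zero]
  have hint : ∀ s, Integrable (fun ω ↦ t s ^ 2 * ((nv X L P n)⁻¹ *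
      (A s).indicator (fun ω ↦ centeredValue X L r P (f s).1 n 0 ω ^ 2) ω)) P := fun s ↦
    (((memLp_centeredValue (hn s)).integrable_sq.indicator (hAmeas s)).const_mul _).const_mul _
  have hmono := integral_mono_of_nonneg
    (.of_forall fun ω ↦ Set.indicator_nonneg (fun y _ ↦ sq_nonneg y) _)
    ((integrable_finsetSum Finset.univ fun s _ ↦ hint s).const_mul ((k : ℝ) ^ 2))
    (.of_forall hpt)
  refine (mul_le_mul_of_nonneg_left hmono (Nat.cast_nonneg _)).trans_eq ?_
  rw [integral_const_mul, integral_finsetSum _ fun s _ ↦ hint s, mul_left_comm, Finset.mul_sum]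
  congr 1
  refine Finset.sum_congr rfl fun s _ ↦ ?_
  rw [integral_const_mul, integral_const_mul, integral_indicator (hAmeas s), mul_left_comm,
    ← mul_assoc ((blockIndices r n).card : ℝ) (nv X L P n)⁻¹, mul_inv_nv (r := r), mul_assoc]

/-- The characteristic functions of the finite-dimensional distributions of the empirical process
converge to those of a centered Gaussian process with covariance `c`. -/
lemma tendsto_integral_exp_empiricalProcess (hX : IsStationary X P) (hBas : Bas X L r P)
    (hLin : Lin X L r P 𝓕) (hCov : Cov X L r P 𝓕 c) (f : Fin k → 𝓕)
    (t : EuclideanSpace ℝ (Fin k))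
    (hT : Tendsto (depCoeff X L r P (fun s => (f s).1) t) atTop (𝓝 0)) :
    Tendsto (fun n ↦ ∫ ω, Complex.exp (Complex.I * (inner ℝ t
        (WithLp.toLp 2 fun s ↦ empiricalProcess X L r P (f s).1 n ω) : ℝ)) ∂P) atTop
      (𝓝 (Complex.exp (-((∑ s, ∑ u, t s * t u * c (f s) (f u)) / 2) : ℝ))) := by
  have hsq := tendsto_card_mul_integral_sq hBas hCov f t
  have hv0 : 0 ≤ ∑ s, ∑ u, t s * t u * c (f s) (f u) :=
    ge_of_tendsto' hsq fun n ↦ mul_nonneg (Nat.cast_nonneg _) (integral_nonneg fun ω ↦ sq_nonneg _)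
  have hpow := tendsto_integral_exp_pow (hCov.eventually_memLp_inner_W f t)
    (hCov.eventually_integral_inner_W f t) (tendsto_card_blockIndices hBas) hv0 hsq
    fun ε hε ↦ tendsto_card_mul_integral_indicator hX hBas hLin hCov f t hε
  have hdiff := squeeze_zero_norm
    (fun n ↦ norm_integral_exp_empiricalProcess_sub_pow_le hX (fun s ↦ (f s).1) t n) hT
  simpa using hdiff.add hpow

end Asymptotics

/-! ### Characteristic functions of the limit, and the conclusion. -/

section Gaussian

variable {Ω' T : Type*} [MeasurableSpace Ω'] {P' : Measure Ω'} {Z : T → Ω' → ℝ} {k : ℕ}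

lemma charFun_apply_map_toLp {Y : Ω' → Fin k → ℝ} (hY : AEMeasurable Y P')
    (t : EuclideanSpace ℝ (Fin k)) :
    charFun (P'.map fun ω ↦ WithLp.toLp 2 (Y ω)) t =
      ∫ ω, Complex.exp (Complex.I * (inner ℝ t (WithLp.toLp 2 (Y ω)) : ℝ)) ∂P' := by
  rw [charFun_apply, integral_map (φ := fun ω ↦ WithLp.toLp 2 (Y ω))
    ((WithLp.measurable_toLp 2 _).comp_aemeasurable hY) (by fun_prop)]
  simp only [mul_comm Complex.I, real_inner_comm t]

lemma integral_exp_inner_isGaussianProcess (hZ : IsGaussianProcess Z P')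
    (hmean : ∀ i, ∫ ω, Z i ω ∂P' = 0) (f : Fin k → T) (t : EuclideanSpace ℝ (Fin k)) :
    ∫ ω, Complex.exp (Complex.I * (inner ℝ t (WithLp.toLp 2 fun s ↦ Z (f s) ω) : ℝ)) ∂P' =
      Complex.exp (-((∑ s, ∑ u, t s * t u * cov[Z (f s), Z (f u); P']) / 2) : ℝ) := by
  have := hZ.isProbabilityMeasure
  have hlp : ∀ s, MemLp (Z (f s)) 2 P' := fun s ↦ (hZ.hasGaussianLaw_eval (f s)).memLp_two
  have hG := ((hZ.comp_right f).smul t).hasGaussianLaw_fun_sum (I := Finset.univ)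
  simp only [Function.comp_apply, smul_eq_mul] at hG
  have h1 : ∫ ω, ∑ s, t s * Z (f s) ω ∂P' = 0 := by
    rw [integral_finsetSum _ fun s _ ↦ ((hlp s).integrable (by norm_num)).const_mul _]
    simp [integral_const_mul, hmean]
  have h2 : Var[fun ω ↦ ∑ s, t s * Z (f s) ω; P'] =
      ∑ s, ∑ u, t s * t u * cov[Z (f s), Z (f u); P'] := by
    rw [variance_fun_sum' fun s _ ↦ (hlp s).const_mul _]
    refine Finset.sum_congr rfl fun s _ ↦ Finset.sum_congr rfl fun u _ ↦ ?_
    rw [covariance_const_mul_left, covariance_const_mul_right, mul_assoc]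
  -- The coefficients `t` are already in the scalar combination, so its characteristic function is
  -- needed only at 1.
  have hc := hG.charFun_map_eq 1
  rw [charFun_apply, integral_map hG.aemeasurable (by fun_prop)] at hc
  simp only [RCLike.inner_apply, conj_trivial, one_mul, mul_one, h1, h2] at hc
  refine Eq.trans (integral_congr_ae (.of_forall fun ω ↦ ?_)) (hc.trans ?_)
  · simp [PiLp.inner_apply, mul_comm]
  · congr 1
    push_cast
    ring

end Gaussian

end ClusterCLT

theorem mainTheorem1 {d p : ℕ} (hd : 1 ≤ d) (hp : 1 ≤ p)
    {Ω : Type*} [MeasurableSpace Ω] (P : Measure Ω) [IsProbabilityMeasure P]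
    (S : ClusterCLT.StateSpace p)
    (X : (Fin d → ℕ) → Ω → EuclideanSpace ℝ (Fin p)) (hX : ClusterCLT.IsStationary X P)
    (L : ClusterCLT.Normalization d S) (r : Fin d → ℕ → ℕ+)
    (𝓕 : Set (ClusterCLT.ClusterFunctional d S)) (c : 𝓕 → 𝓕 → ℝ)
    (hBas : ClusterCLT.Bas X L r P)
    (hLin : ClusterCLT.Lin X L r P 𝓕)
    (hCov : ClusterCLT.Cov X L r P 𝓕 c)
    (hT : ∀ (k : ℕ) (f : Fin k → 𝓕) (t : EuclideanSpace ℝ (Fin k)),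
      Tendsto (ClusterCLT.depCoeff X L r P (fun s => (f s).1) t) atTop (𝓝 0)) :
    ∃ (Ω' : Type) (_ : MeasurableSpace Ω') (P' : Measure Ω') (_ : IsProbabilityMeasure P')
      (Z : 𝓕 → Ω' → ℝ),
      IsGaussianProcess Z P' ∧
      (∀ f, ∫ ω, Z f ω ∂P' = 0) ∧
      (∀ f g, covariance (Z f) (Z g) P' = c f g) ∧
      ∀ (k : ℕ) (f : Fin k → 𝓕),
        TendstoInDistribution
          (fun (n : Fin d → ℕ) ω (s : Fin k) =>
            ClusterCLT.empiricalProcess X L r P (f s).1 n ω)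
          atTop (fun ω (s : Fin k) => Z (f s) ω) (fun _ => P) P' := by
  obtain ⟨Ω', _, P', _, Z, hZ, hmean, hcov⟩ :=
    ClusterCLT.exists_isGaussianProcess c hCov.symm hCov.sum_nonneg
  refine ⟨Ω', inferInstance, P', inferInstance, Z, hZ, hmean, hcov, fun k f ↦ ?_⟩
  have hmeas : ∀ n, AEMeasurable
      (fun ω (s : Fin k) ↦ ClusterCLT.empiricalProcess X L r P (f s).1 n ω) P := fun n ↦
    aemeasurable_pi_lambda _ fun s ↦
      (ClusterCLT.measurable_empiricalProcess hX _ n).aemeasurable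
  have hmeasZ : AEMeasurable (fun ω (s : Fin k) ↦ Z (f s) ω) P' :=
    aemeasurable_pi_lambda _ fun s ↦ hZ.aemeasurable (f s)
  -- Characteristic functions need an inner product, so convergence is proved in `EuclideanSpace`
  -- and carried back by the continuous map `ofLp`.
  have hE : TendstoInDistribution
      (fun (n : Fin d → ℕ) ω ↦ WithLp.toLp 2 fun s : Fin k ↦
        ClusterCLT.empiricalProcess X L r P (f s).1 n ω)
      atTop (fun ω ↦ WithLp.toLp 2 fun s : Fin k ↦ Z (f s) ω) (fun _ ↦ P) P' := by
    refine ⟨fun n ↦ (WithLp.measurable_toLp 2 _).comp_aemeasurable (hmeas n),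
      (WithLp.measurable_toLp 2 _).comp_aemeasurable hmeasZ, ?_⟩
    refine ClusterCLT.tendsto_of_tendsto_charFun fun t ↦ ?_
    simp only [ProbabilityMeasure.coe_mk, ClusterCLT.charFun_apply_map_toLp (hmeas _),
      ClusterCLT.charFun_apply_map_toLp hmeasZ,
      ClusterCLT.integral_exp_inner_isGaussianProcess hZ hmean f t, hcov]
    exact ClusterCLT.tendsto_integral_exp_empiricalProcess hX hBas hLin hCov f t (hT k f t)
  exact hE.continuous_comp (PiLp.continuous_ofLp 2 fun _ : Fin k ↦ ℝ)
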